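/- Let $d\ge 3$ and let $f:[0,\infty)\to\mathbb R$ be any increasing (i.e. non-decreasing) unbounded function. Then there is a sequence of pairwise disjoint closed balls $\overline B(c_n,r_n)\subset\mathbb R^d$, $n\ge 1$, with $r_n>0$, none of which contains the origin, such that 1. (separated) there is $\epsilon>0$ with $|c_n-c_m|\ge 2\epsilon$ for all $n\ne m$; 2. (avoidable) with positive probability, Brownian motion in $\mathbb R^d$ started at $0$ never hits any of the balls; 3. $r_n^{d-2}|c_n|^2\le f(|c_n|)$ for every $n\ge 1$; 4. $\displaystyle\sum_{n=1}^\infty\left(\frac{r_n}{|c_n|}\right)^{d-2}=\infty$. -/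

import Mathlib

open Set Filter MeasureTheory ProbabilityTheory
open scoped NNReal

universe u

/-- `W` is a standard Brownian motion in `ℝ^d` starting from the origin: its coordinates are
independent real Brownian motions (Mathlib's `IsBrownianReal`, which start at `0` almost surely
and have almost surely continuous paths). -/
structure IsBrownianVec {d : ℕ} {Ω : Type u} [MeasurableSpace Ω]
    (W : ℝ≥0 → Ω → EuclideanSpace ℝ (Fin d)) (P : Measure Ω) : Prop where
  coord : ∀ i : Fin d, IsBrownianReal (fun t ω => W t ω i) P
  indep : iIndepFun (fun (i : Fin d) (ω : Ω) (t : ℝ≥0) => W t ω i) P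

/-- The complement of the union of the closed balls with centres `c n` and radii `r n`. -/
def ballComplement {d : ℕ} (c : ℕ → EuclideanSpace ℝ (Fin d)) (r : ℕ → ℝ) :
    Set (EuclideanSpace ℝ (Fin d)) :=
  (⋃ n, Metric.closedBall (c n) (r n))ᶜ

/-- A countably infinite collection of non-overlapping closed balls of positive radius, none of
which contains the origin. -/
structure IsBallCollection {d : ℕ} (c : ℕ → EuclideanSpace ℝ (Fin d)) (r : ℕ → ℝ) : Prop where
  radius_pos : ∀ n, 0 < r n
  disjoint : Pairwise fun n m =>
    Disjoint (Metric.closedBall (c n) (r n)) (Metric.closedBall (c m) (r m))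
  zero_mem : (0 : EuclideanSpace ℝ (Fin d)) ∈ ballComplement c r

/-- The centres are uniformly separated. -/
def IsSeparatedCollection {d : ℕ} (c : ℕ → EuclideanSpace ℝ (Fin d)) : Prop :=
  ∃ ε : ℝ, 0 < ε ∧ ∀ n m, n ≠ m → 2 * ε ≤ ‖c n - c m‖

/-- The collection is avoidable: Brownian motion starting from the origin has positive
probability of never hitting any of the balls. This probability depends only on the law of
Brownian motion, so the requirement is made for every realization `W` of Brownian motion on a
probability space. -/
def IsAvoidable {d : ℕ} (c : ℕ → EuclideanSpace ℝ (Fin d)) (r : ℕ → ℝ) : Prop :=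
  ∀ (Ω : Type u) [MeasurableSpace Ω] (P : Measure Ω) [IsProbabilityMeasure P]
    (W : ℝ≥0 → Ω → EuclideanSpace ℝ (Fin d)), IsBrownianVec W P →
    0 < P {ω | ∀ t : ℝ≥0, W t ω ∈ ballComplement c r}

/-! The capacities of many small balls can have a large sum although the balls lie together in one
ball of small angular size, which is rarely hit. Choose δ_k so that balls B(x, δ_k|x|) are hit with
probabilities summing to less than 1 (`exists_hit_le`), and place in the k-th one a cube of M^d
lattice points at distance about R = CM from the origin. With r^(d-2) = T/R² for a constant T
depending only on C and d, each of the M^d terms (r/|c|)^(d-2) is at least M^(-d), so every cluster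
contributes at least 1 to the series. Meanwhile r^(d-2)|c|² ≤ 4T ≤ f(R) once M is large, since f
tends to infinity (`exists_cluster`).

The hitting bound uses the potential h(x) = ∫_1^∞ p_s(x) ds of the heat kernel, finite and vanishing
at infinity when d ≥ 3. A Gaussian increment only delays the kernel in time, so h decreases in mean
along a Gaussian walk, which bounds the probability of entering the unit ball
(`heatPotential_mul_walk_hit_le`). Scaling, dyadic times and continuity of paths transfer the bound
to Brownian motion (`heatPotential_mul_hit_le`). -/

/-- Completing the square in z; the last factor is a probability density, so it integrates to 1. -/
lemma gaussianPDFReal_add_mul {s t : ℝ≥0} (hs : s ≠ 0) (ht : t ≠ 0) (y z : ℝ) :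
    gaussianPDFReal 0 s (y + z) * gaussianPDFReal 0 t z =
      gaussianPDFReal 0 (s + t) y * gaussianPDFReal (-(y * t / (s + t))) (s * t / (s + t)) z := by
  have hs' : (0 : ℝ) < s := by positivity
  have ht' : (0 : ℝ) < t := by positivity
  simp only [gaussianPDFReal]
  rw [mul_mul_mul_comm, mul_mul_mul_comm (√(2 * Real.pi * ↑(s + t)))⁻¹, ← Real.exp_add, ← Real.exp_add, ← mul_inv,
    ← mul_inv, ← Real.sqrt_mul (by positivity), ← Real.sqrt_mul (by positivity)]
  congr 1
  · congr 2
    push_cast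
    field_simp
  · congr 1
    push_cast
    field_simp
    ring

/-- Convolving a centred Gaussian density with a centred Gaussian law adds the variances. -/
lemma lintegral_gaussianPDF_add {s t : ℝ≥0} (hs : s ≠ 0) (ht : t ≠ 0) (y : ℝ) :
    ∫⁻ z, gaussianPDF 0 s (y + z) ∂(gaussianReal 0 t) = gaussianPDF 0 (s + t) y := by
  have hm : Measurable fun z => gaussianPDF 0 s (y + z) :=
    (measurable_gaussianPDF _ _).comp (measurable_const_add y)
  rw [gaussianReal_of_var_ne_zero _ ht,
    lintegral_withDensity_eq_lintegral_mul _ (measurable_gaussianPDF _ _) hm]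
  have h : ∀ z, (gaussianPDF 0 t * fun z => gaussianPDF 0 s (y + z)) z =
      gaussianPDF 0 (s + t) y * gaussianPDF (-(y * t / (s + t))) (s * t / (s + t)) z := by
    intro z
    simp only [Pi.mul_apply, gaussianPDF]
    rw [← ENNReal.ofReal_mul (gaussianPDFReal_nonneg _ _ _),
      ← ENNReal.ofReal_mul (gaussianPDFReal_nonneg _ _ _), mul_comm,
      gaussianPDFReal_add_mul hs ht]
  have hst : s * t / (s + t) ≠ 0 := by positivity
  simp_rw [h]
  rw [lintegral_const_mul _ (measurable_gaussianPDF _ _), lintegral_gaussianPDF_eq_one _ hst,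
    mul_one]

/-! ### The heat potential and its decay -/

/-- The Gaussian heat kernel in dimension `d` at time `s`, at a point with squared norm `q`. -/
noncomputable def heatKernel (d : ℕ) (s q : ℝ) : ℝ :=
  (√(2 * Real.pi * s))⁻¹ ^ d * Real.exp (-q / (2 * s))

/-- The time integral over `(1, ∞)` of the heat kernel, at a point with squared norm `q`. -/
noncomputable def heatPotential (d : ℕ) (q : ℝ) : ENNReal :=
  ∫⁻ s in Ioi (1 : ℝ), ENNReal.ofReal (heatKernel d s q)

lemma measurable_heatKernel (d : ℕ) : Measurable fun p : ℝ × ℝ => heatKernel d p.1 p.2 := by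
  unfold heatKernel
  fun_prop

lemma heatPotential_antitone (d : ℕ) : Antitone (heatPotential d) := by
  intro a b hab
  refine setLIntegral_mono' measurableSet_Ioi fun s hs => ENNReal.ofReal_le_ofReal ?_
  have hs0 : (0 : ℝ) < s := one_pos.trans hs
  unfold heatKernel
  gcongr

lemma heatPotential_pos (d : ℕ) (q : ℝ) : 0 < heatPotential d q := by
  unfold heatPotential
  rw [setLIntegral_pos_iff]
  · have : Function.support (fun s => ENNReal.ofReal (heatKernel d s q)) ∩ Ioi 1 = Ioi 1 := by
      refine inter_eq_right.2 fun s hs => ?_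
      have hs0 : (0 : ℝ) < s := one_pos.trans hs
      have : 0 < heatKernel d s q := by unfold heatKernel; positivity
      simpa [Function.mem_support] using this
    rw [this]
    simp
  · exact ((measurable_heatKernel d).comp (measurable_id.prodMk measurable_const)).ennreal_ofReal

/-- A dominating function independent of q, integrable on (1, ∞) when d ≥ 3. -/
lemma heatKernel_le_rpow (d : ℕ) {s q : ℝ} (hs : 1 < s) (hq : 0 ≤ q) :
    heatKernel d s q ≤ s ^ (-(d : ℝ) / 2) := by
  have hs0 : 0 < s := one_pos.trans hs
  have h1 : (√(2 * Real.pi * s))⁻¹ ^ d ≤ (√s)⁻¹ ^ d := by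
    gcongr
    nlinarith [Real.pi_gt_three]
  have h2 : Real.exp (-q / (2 * s)) ≤ 1 := by
    rw [Real.exp_le_one_iff]
    exact div_nonpos_of_nonpos_of_nonneg (by linarith) (by positivity)
  have h3 : s ^ (-(d : ℝ) / 2) = (√s)⁻¹ ^ d := by
    rw [Real.sqrt_eq_rpow, ← Real.rpow_neg hs0.le, ← Real.rpow_natCast, ← Real.rpow_mul hs0.le]
    congr 1
    ring
  rw [h3]
  unfold heatKernel
  calc _ ≤ (√s)⁻¹ ^ d * 1 := by gcongr
    _ = _ := mul_one _

lemma lintegral_rpow_neg_half_ne_top {d : ℕ} (hd : 3 ≤ d) :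
    ∫⁻ s in Ioi (1 : ℝ), ENNReal.ofReal (s ^ (-(d : ℝ) / 2)) ≠ ⊤ := by
  have hd' : (3 : ℝ) ≤ d := by exact_mod_cast hd
  have hi : IntegrableOn (fun s : ℝ => s ^ (-(d : ℝ) / 2)) (Ioi 1) :=
    integrableOn_Ioi_rpow_of_lt (by linarith) one_pos
  exact hi.lintegral_lt_top.ne

lemma heatPotential_ne_top {d : ℕ} (hd : 3 ≤ d) {q : ℝ} (hq : 0 ≤ q) : heatPotential d q ≠ ⊤ :=
  ne_top_of_le_ne_top (lintegral_rpow_neg_half_ne_top hd)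
    (setLIntegral_mono' measurableSet_Ioi fun _ hs =>
      ENNReal.ofReal_le_ofReal (heatKernel_le_rpow d hs hq))

/-- The potential vanishes at infinity: transience in dimension at least three. -/
lemma tendsto_heatPotential {d : ℕ} (hd : 3 ≤ d) :
    Tendsto (fun n : ℕ => heatPotential d n) atTop (nhds 0) := by
  have h := tendsto_lintegral_of_dominated_convergence (μ := volume.restrict (Ioi (1 : ℝ)))
    (F := fun (n : ℕ) s => ENNReal.ofReal (heatKernel d s n)) (f := fun _ => 0)
    (fun s => ENNReal.ofReal (s ^ (-(d : ℝ) / 2)))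
    (fun n => ((measurable_heatKernel d).comp
      (measurable_id.prodMk measurable_const)).ennreal_ofReal)
    (fun n => ?_) ?_ ?_
  · simpa [heatPotential] using h
  · filter_upwards [ae_restrict_mem measurableSet_Ioi] with s hs
    exact ENNReal.ofReal_le_ofReal (heatKernel_le_rpow d hs n.cast_nonneg)
  · exact lintegral_rpow_neg_half_ne_top hd
  · filter_upwards [ae_restrict_mem measurableSet_Ioi] with s hs
    have hs0 : (0 : ℝ) < s := one_pos.trans hs
    rw [← ENNReal.ofReal_zero]
    refine (ENNReal.continuous_ofReal.tendsto 0).comp ?_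
    rw [← mul_zero ((√(2 * Real.pi * s))⁻¹ ^ d)]
    refine Tendsto.const_mul _ (Real.tendsto_exp_atBot.comp ?_)
    refine Tendsto.atBot_div_const (by positivity) ?_
    exact tendsto_neg_atTop_atBot.comp tendsto_natCast_atTop_atTop

lemma exists_heatPotential_le {d : ℕ} (hd : 3 ≤ d) {η : ENNReal} (hη : 0 < η) :
    ∃ L : ℝ, 0 < L ∧ ∀ q, L ≤ q → heatPotential d q ≤ η := by
  obtain ⟨n, hn, hn0⟩ := (((tendsto_heatPotential hd).eventually (ge_mem_nhds hη)).and
    (eventually_gt_atTop 0)).exists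
  exact ⟨n, by exact_mod_cast hn0, fun q hq => (heatPotential_antitone d hq).trans hn⟩

lemma ofReal_heatKernel_eq_prod {d : ℕ} {s : ℝ} (hs : 0 ≤ s) (y : Fin d → ℝ) :
    ENNReal.ofReal (heatKernel d s (∑ i, y i ^ 2)) = ∏ i, gaussianPDF 0 s.toNNReal (y i) := by
  simp only [gaussianPDF]
  rw [← ENNReal.ofReal_prod_of_nonneg fun i _ => gaussianPDFReal_nonneg _ _ _]
  simp only [gaussianPDFReal, heatKernel, Real.coe_toNNReal s hs, sub_zero]
  rw [Finset.prod_mul_distrib, ← Real.exp_sum]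
  simp [← Finset.sum_div]

/-- The heat potential is superharmonic for Gaussian increments. -/
lemma lintegral_heatPotential_add_le {d : ℕ} {Ω : Type*} [MeasurableSpace Ω] {P : Measure Ω}
    {X : Fin d → Ω → ℝ} {v : ℝ≥0} (hv : v ≠ 0) (hm : ∀ i, Measurable (X i))
    (hi : iIndepFun X P) (hl : ∀ i, P.map (X i) = gaussianReal 0 v) (y : Fin d → ℝ) :
    ∫⁻ ω, heatPotential d (∑ i, (y i + X i ω) ^ 2) ∂P ≤ heatPotential d (∑ i, y i ^ 2) := by
  have := hi.isProbabilityMeasure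
  have hinner : ∀ s : ℝ, 1 < s →
      ∫⁻ ω, ENNReal.ofReal (heatKernel d s (∑ i, (y i + X i ω) ^ 2)) ∂P =
        ENNReal.ofReal (heatKernel d (s + v) (∑ i, y i ^ 2)) := by
    intro s hs
    have hs0 : 0 < s := one_pos.trans hs
    have hs' : s.toNNReal ≠ 0 := by simpa using hs0
    rw [ofReal_heatKernel_eq_prod (by positivity)]
    simp_rw [ofReal_heatKernel_eq_prod hs0.le]
    have hg : ∀ i, Measurable fun x => gaussianPDF 0 s.toNNReal (y i + x) := fun i =>
      (measurable_gaussianPDF _ _).comp (measurable_const_add (y i))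
    rw [lintegral_prod_eq_prod_lintegral_of_indepFun Finset.univ
      (fun i ω => gaussianPDF 0 s.toNNReal (y i + X i ω)) (hi.comp _ hg)
      (fun i => (hg i).comp (hm i))]
    refine Finset.prod_congr rfl fun i _ => ?_
    rw [← lintegral_map (hg i) (hm i), hl, lintegral_gaussianPDF_add hs' hv,
      Real.toNNReal_add hs0.le v.coe_nonneg, Real.toNNReal_coe]
  unfold heatPotential
  rw [lintegral_lintegral_swap]
  · calc ∫⁻ s in Ioi (1 : ℝ), ∫⁻ ω, ENNReal.ofReal (heatKernel d s (∑ i, (y i + X i ω) ^ 2)) ∂P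
        = ∫⁻ s in Ioi (1 : ℝ), ENNReal.ofReal (heatKernel d (s + v) (∑ i, y i ^ 2)) :=
          setLIntegral_congr_fun measurableSet_Ioi fun s hs => hinner s hs
      _ = ∫⁻ s in Ioi (1 + (v : ℝ)), ENNReal.ofReal (heatKernel d s (∑ i, y i ^ 2)) := by
          have hk : Measurable fun s => ENNReal.ofReal (heatKernel d s (∑ i, y i ^ 2)) :=
            ((measurable_heatKernel d).comp (measurable_id.prodMk measurable_const)).ennreal_ofReal
          rw [← (measurePreserving_add_right volume (v : ℝ)).setLIntegral_comp_preimage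
            measurableSet_Ioi hk]
          simp
      -- The increment has shifted the time domain from (1, ∞) to (1 + v, ∞); the part lost is the
      -- source of superharmonicity.
      _ ≤ _ := lintegral_mono_set (Ioi_subset_Ioi (by simp))
  · refine Measurable.aemeasurable (Measurable.ennreal_ofReal ?_)
    have hq : Measurable fun p : Ω × ℝ => ∑ i, (y i + X i p.1) ^ 2 :=
      Finset.measurable_fun_sum _ fun i _ => by fun_prop
    exact (measurable_heatKernel d).comp (measurable_snd.prodMk hq)

/-! ### Hitting probabilities: from random walk to Brownian motion -/

/-- A Gaussian random walk started at `y` enters the unit ball with probability at most the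
normalized heat potential of `y`. -/
lemma heatPotential_mul_walk_hit_le {d : ℕ} {Ω : Type*} [MeasurableSpace Ω] {P : Measure Ω}
    {v : ℝ≥0} (hv : v ≠ 0) (n : ℕ) (D : Fin d → ℕ → Ω → ℝ) (hm : ∀ i k, Measurable (D i k))
    (hi : iIndepFun (fun p : Fin d × ℕ => D p.1 p.2) P)
    (hl : ∀ i k, P.map (D i k) = gaussianReal 0 v) (y : Fin d → ℝ) :
    heatPotential d 1 * P {ω | ∃ k ≤ n, ∑ i, (y i + ∑ j ∈ Finset.range k, D i j ω) ^ 2 ≤ 1} ≤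
      heatPotential d (∑ i, y i ^ 2) := by
  have := hi.isProbabilityMeasure
  by_cases hy : ∑ i, y i ^ 2 ≤ 1
  · calc _ ≤ heatPotential d 1 * 1 := by gcongr; exact prob_le_one
      _ ≤ _ := by rw [mul_one]; exact heatPotential_antitone d hy
  induction n generalizing D y with
  | zero =>
    have : {ω | ∃ k ≤ 0, ∑ i, (y i + ∑ j ∈ Finset.range k, D i j ω) ^ 2 ≤ 1} = ∅ := by
      ext ω
      simpa using hy
    rw [this, measure_empty, mul_zero]
    exact zero_le
  | succ n ih =>
    -- Markov property at the first step: X is the first increment, Z the later ones. Z is cut off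
    -- at n so that independence of finite families suffices; the default 0 never enters the sums
    -- considered.
    let X : Ω → Fin d → ℝ := fun ω i => D i 0 ω
    let Z : Ω → Fin d → ℕ → ℝ := fun ω i j => if j < n then D i (j + 1) ω else 0
    let A : Set ((Fin d → ℝ) × (Fin d → ℕ → ℝ)) :=
      {p | ∃ k ≤ n, ∑ i, (y i + p.1 i + ∑ j ∈ Finset.range k, p.2 i j) ^ 2 ≤ 1}
    have hX : Measurable X := measurable_pi_lambda _ fun i => hm i 0
    have hZ : Measurable Z := by
      refine measurable_pi_lambda _ fun i => measurable_pi_lambda _ fun j => ?_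
      by_cases hj : j < n
      · simpa [Z, hj] using hm i (j + 1)
      · simp [Z, hj]
    have hA : MeasurableSet A := by
      have hA' : A = ⋃ k ∈ Finset.range (n + 1),
          {p | ∑ i, (y i + p.1 i + ∑ j ∈ Finset.range k, p.2 i j) ^ 2 ≤ 1} := by
        ext p
        simp [A]
      rw [hA']
      refine Finset.measurableSet_biUnion _ fun k _ => measurableSet_le ?_ measurable_const
      refine Finset.measurable_fun_sum _ fun i _ => ?_
      have h1 : Measurable fun p : (Fin d → ℝ) × (Fin d → ℕ → ℝ) =>
          ∑ j ∈ Finset.range k, p.2 i j :=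
        Finset.measurable_fun_sum _ fun j _ => by fun_prop
      fun_prop
    have hZD : ∀ ω, ∀ k ≤ n, ∀ i,
        ∑ j ∈ Finset.range k, Z ω i j = ∑ j ∈ Finset.range k, D i (j + 1) ω := by
      intro ω k hk i
      refine Finset.sum_congr rfl fun j hj => ?_
      have : j < n := (Finset.mem_range.1 hj).trans_le hk
      simp [Z, this]
    have hXZ : IndepFun X Z P := by
      have h := hi.indepFun_finset (Finset.univ ×ˢ {0}) (Finset.univ ×ˢ Finset.Icc 1 n)
        (by
          rw [Finset.disjoint_product]
          right
          simp) (fun p => hm p.1 p.2)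
      have h' := h.comp (φ := fun (w : (Finset.univ ×ˢ {0} : Finset (Fin d × ℕ)) → ℝ) i =>
          w ⟨(i, 0), by simp⟩)
        (ψ := fun (w : (Finset.univ ×ˢ Finset.Icc 1 n : Finset (Fin d × ℕ)) → ℝ) i j =>
          if hj : j < n then w ⟨(i, j + 1), by simpa using hj⟩ else 0)
        (by fun_prop)
        (by
          refine measurable_pi_lambda _ fun i => measurable_pi_lambda _ fun j => ?_
          by_cases hj : j < n
          · simpa [hj] using measurable_pi_apply _
          · simp [hj])
      have hZ' : Z = (fun (w : (Finset.univ ×ˢ Finset.Icc 1 n : Finset (Fin d × ℕ)) → ℝ) i j =>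
          if hj : j < n then w ⟨(i, j + 1), by simpa using hj⟩ else 0) ∘
            fun ω p => D p.1.1 p.1.2 ω := by
        ext ω i j
        by_cases hj : j < n <;> simp [Z, hj]
      rw [hZ']
      exact h'
    have hset : {ω | ∃ k ≤ n + 1, ∑ i, (y i + ∑ j ∈ Finset.range k, D i j ω) ^ 2 ≤ 1} =
        (fun ω => (X ω, Z ω)) ⁻¹' A := by
      ext ω
      simp only [mem_ofPred_eq, mem_preimage, A]
      constructor
      · rintro ⟨k, hk, h⟩
        obtain _ | k := k
        · simp only [Finset.range_zero, Finset.sum_empty, add_zero] at h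
          exact absurd h hy
        · refine ⟨k, by omega, ?_⟩
          simp_rw [hZD ω k (by omega)]
          simpa [Finset.sum_range_succ', X, add_assoc, add_comm (D _ 0 ω)] using h
      · rintro ⟨k, hk, h⟩
        refine ⟨k + 1, by omega, ?_⟩
        simp_rw [hZD ω k hk] at h
        simpa [Finset.sum_range_succ', X, add_assoc, add_comm (D _ 0 ω)] using h
    have hprod : P ((fun ω => (X ω, Z ω)) ⁻¹' A) = ∫⁻ ω, P.map Z (Prod.mk (X ω) ⁻¹' A) ∂P := by
      rw [← Measure.map_apply (hX.prodMk hZ) hA,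
        (indepFun_iff_map_prod_eq_prod_map_map hX.aemeasurable hZ.aemeasurable).1 hXZ,
        Measure.prod_apply hA, lintegral_map (measurable_measure_prodMk_left hA) hX]
    have hstep : ∀ ω, heatPotential d 1 * P.map Z (Prod.mk (X ω) ⁻¹' A) ≤
        heatPotential d (∑ i, (y i + X ω i) ^ 2) := by
      intro ω
      by_cases hyω : ∑ i, (y i + X ω i) ^ 2 ≤ 1
      · calc _ ≤ heatPotential d 1 * 1 := by
              gcongr
              have := Measure.isProbabilityMeasure_map (μ := P) hZ.aemeasurable
              exact prob_le_one
          _ ≤ _ := by rw [mul_one]; exact heatPotential_antitone d hyω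
      · rw [Measure.map_apply hZ (measurable_prodMk_left hA)]
        refine le_trans (le_of_eq ?_) (ih (fun i k => D i (k + 1)) (fun i k => hm i (k + 1))
          (hi.precomp (g := fun p : Fin d × ℕ => (p.1, p.2 + 1)) ?_)
          (fun i k => hl i (k + 1)) (fun i => y i + X ω i) hyω)
        · congr 2
          ext ω'
          simp only [A, mem_preimage, mem_ofPred_eq]
          refine exists_congr fun k => and_congr_right fun hk => ?_
          simp_rw [hZD ω' k hk]
        · rintro ⟨a, b⟩ ⟨a', b'⟩ h
          simpa using h
    have hmeas : Measurable fun ω => P.map Z (Prod.mk (X ω) ⁻¹' A) :=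
      (measurable_measure_prodMk_left hA).comp hX
    rw [hset, hprod, ← lintegral_const_mul _ hmeas]
    refine (lintegral_mono hstep).trans (lintegral_heatPotential_add_le hv (fun i => hm i 0)
      (hi.precomp (g := fun i : Fin d => (i, 0)) ?_) (fun i => hl i 0) y)
    intro a b h
    simpa using h

/-- Brownian motion observed on an arithmetic grid of times hits a ball with probability controlled
by the heat potential. -/
lemma heatPotential_mul_grid_hit_le {d : ℕ} {Ω : Type*} [MeasurableSpace Ω] {P : Measure Ω}
    {W : ℝ≥0 → Ω → EuclideanSpace ℝ (Fin d)} (hW : IsBrownianVec W P) [IsProbabilityMeasure P]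
    {τ : ℝ≥0} (hτ : τ ≠ 0) {ρ : ℝ} (hρ : 0 < ρ) (x : EuclideanSpace ℝ (Fin d)) (n : ℕ) :
    heatPotential d 1 * P {ω | ∃ k ≤ n, W (k * τ) ω ∈ Metric.closedBall x ρ} ≤
      heatPotential d (‖x‖ ^ 2 / ρ ^ 2) := by
  let c : ℝ≥0 := ⟨ρ⁻¹, by positivity⟩
  have hc : c ≠ 0 := by
    intro h
    have : ρ⁻¹ = 0 := congrArg NNReal.toReal h
    exact hρ.ne' (inv_eq_zero.1 this)
  have hmono : Monotone fun k : ℕ => (k : ℝ≥0) * τ := fun a b h => by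
    dsimp only
    gcongr
  -- Dividing by ρ reduces to the unit ball, with the walk started at -x/ρ.
  let G : Fin d → ℕ → Ω → ℝ := fun i k ω => ρ⁻¹ * (W ((k + 1 : ℕ) * τ) ω i - W (k * τ) ω i)
  have hlaw : ∀ i k, HasLaw (G i k) (gaussianReal 0 (c ^ 2 * τ)) P := by
    intro i k
    have h := gaussianReal_const_mul ((hW.coord i).hasLaw_sub ((k + 1 : ℕ) * τ) (k * τ)) ρ⁻¹
    have hdist : nndist (((k + 1 : ℕ) * τ : ℝ≥0) : ℝ) ((k * τ : ℝ≥0) : ℝ) = τ := by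
      ext
      rw [coe_nndist, Real.dist_eq]
      push_cast
      rw [show ((k : ℝ) + 1) * τ - k * τ = τ by ring, abs_of_nonneg τ.coe_nonneg]
    rw [mul_zero] at h
    refine Eq.mp ?_ h
    congr 2
    exact congrArg (fun a => (⟨ρ⁻¹ ^ 2, sq_nonneg _⟩ : ℝ≥0) * a) hdist
  have hG : ∀ i, iIndepFun (G i) P := fun i =>
    ((hW.coord i).hasIndepIncrements.nat hmono).comp (fun _ z => ρ⁻¹ * z) fun _ => by fun_prop
  have hG' : iIndepFun (fun i ω k => G i k ω) P :=
    hW.indep.comp (fun _ w (k : ℕ) => ρ⁻¹ * (w ((k + 1 : ℕ) * τ) - w (k * τ)))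
      fun _ => by fun_prop
  -- Increments are only a.e. measurable, whereas the walk lemma needs measurable ones.
  let D : Fin d → ℕ → Ω → ℝ := fun i k => (hlaw i k).aemeasurable.mk (G i k)
  have hDG : ∀ i k, G i k =ᵐ[P] D i k := fun i k => (hlaw i k).aemeasurable.ae_eq_mk
  have hDm : ∀ i k, Measurable (D i k) := fun i k => (hlaw i k).aemeasurable.measurable_mk
  have hDi : iIndepFun (fun p : Fin d × ℕ => D p.1 p.2) P := by
    refine iIndepFun_uncurry' hDm (hG'.congr fun i => ?_) fun i => (hG i).congr (hDG i)
    filter_upwards [ae_all_iff.2 (hDG i)] with ω hω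
    exact funext hω
  have hDl : ∀ i k, P.map (D i k) = gaussianReal 0 (c ^ 2 * τ) := fun i k => by
    rw [← (hlaw i k).map_eq, Measure.map_congr (hDG i k)]
  have key := heatPotential_mul_walk_hit_le (P := P) (v := c ^ 2 * τ) (by positivity) n D hDm hDi hDl
    (fun i => -(ρ⁻¹ * x i))
  have hnorm : ∑ i, (-(ρ⁻¹ * x i)) ^ 2 = ‖x‖ ^ 2 / ρ ^ 2 := by
    rw [EuclideanSpace.real_norm_sq_eq, Finset.sum_div]
    refine Finset.sum_congr rfl fun i _ => ?_
    field_simp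
  rw [hnorm] at key
  refine le_trans ?_ key
  refine mul_le_mul_right ?_ _
  refine measure_mono_ae ?_
  filter_upwards [ae_all_iff.2 fun i => ae_all_iff.2 (hDG i),
    ae_all_iff.2 fun i => (hW.coord i).eval_zero_ae_eq_zero] with ω h1 h2
  rintro ⟨k, hk, h⟩
  refine ⟨k, hk, ?_⟩
  have hsum : ∀ i, ∑ j ∈ Finset.range k, D i j ω = ρ⁻¹ * W (k * τ) ω i := by
    intro i
    simp_rw [← h1, G, ← Finset.mul_sum]
    rw [Finset.sum_range_sub (fun j => W (j * τ) ω i)]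
    simp [h2]
  rw [mem_closedBall_iff_norm] at h
  have h3 : ∑ i, (-(ρ⁻¹ * x i) + ∑ j ∈ Finset.range k, D i j ω) ^ 2 =
      ‖W (k * τ) ω - x‖ ^ 2 / ρ ^ 2 := by
    rw [EuclideanSpace.real_norm_sq_eq, Finset.sum_div]
    refine Finset.sum_congr rfl fun i _ => ?_
    rw [hsum, PiLp.sub_apply]
    field_simp
    ring
  rw [h3, div_le_one (by positivity)]
  gcongr

lemma IsBrownianVec.ae_continuous {d : ℕ} {Ω : Type*} [MeasurableSpace Ω] {P : Measure Ω}
    {W : ℝ≥0 → Ω → EuclideanSpace ℝ (Fin d)} (hW : IsBrownianVec W P) :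
    ∀ᵐ ω ∂P, Continuous fun t => W t ω := by
  filter_upwards [ae_all_iff.2 fun i => (hW.coord i).cont] with ω hω
  exact (PiLp.continuous_toLp 2 _).comp (continuous_pi hω)

/-- Dyadic rationals come arbitrarily close to any time. -/
lemma exists_dyadic_mem_of_isOpen {s : Set ℝ≥0} (hs : IsOpen s) (hne : s.Nonempty) :
    ∃ m k : ℕ, k ≤ 4 ^ m ∧ (k : ℝ≥0) * (2 ^ m)⁻¹ ∈ s := by
  obtain ⟨t, ht⟩ := hne
  have hlim : Tendsto (fun m : ℕ => (⌊t * 2 ^ m⌋₊ : ℝ≥0) * (2 ^ m)⁻¹) atTop (nhds t) := by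
    have h := (tendsto_nat_floor_mul_div_atTop (R := ℝ) t.coe_nonneg).comp
      (tendsto_pow_atTop_atTop_of_one_lt (one_lt_two (α := ℝ)))
    rw [← NNReal.tendsto_coe]
    refine h.congr fun m => ?_
    have : ⌊t * 2 ^ m⌋₊ = ⌊(t : ℝ) * 2 ^ m⌋₊ := by
      rw [← NNReal.coe_ofNat, ← NNReal.coe_pow, ← NNReal.coe_mul]
      exact (Nonneg.nat_floor_coe _).symm
    simp [this, div_eq_mul_inv]
  have hbig : ∀ᶠ m : ℕ in atTop, t ≤ 2 ^ m :=
    (tendsto_pow_atTop_atTop_of_one_lt (one_lt_two (α := ℝ≥0))).eventually_ge_atTop t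
  obtain ⟨m, hm, hm'⟩ := ((hlim.eventually (hs.mem_nhds ht)).and hbig).exists
  refine ⟨m, _, ?_, hm⟩
  have : (⌊t * 2 ^ m⌋₊ : ℝ≥0) ≤ 4 ^ m := by
    calc _ ≤ t * 2 ^ m := Nat.floor_le zero_le
      _ ≤ 2 ^ m * 2 ^ m := by gcongr
      _ = 4 ^ m := by rw [← mul_pow]; norm_num
  exact_mod_cast this

/-- Brownian motion hits a ball with probability controlled by the heat potential. -/
lemma heatPotential_mul_hit_le {d : ℕ} {Ω : Type*} [MeasurableSpace Ω] {P : Measure Ω}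
    {W : ℝ≥0 → Ω → EuclideanSpace ℝ (Fin d)} (hW : IsBrownianVec W P) [IsProbabilityMeasure P]
    {ρ : ℝ} (hρ : 0 < ρ) (x : EuclideanSpace ℝ (Fin d)) :
    heatPotential d 1 * P {ω | ∃ t, W t ω ∈ Metric.closedBall x ρ} ≤
      heatPotential d (‖x‖ ^ 2 / (2 * ρ) ^ 2) := by
  -- The grid has mesh 2^(-m) and horizon 2^m. The radius is doubled so that a path meeting the
  -- closed ball spends an open set of times in a larger one, hence is seen at a dyadic time.
  let A : ℕ → Set Ω := fun m =>
    {ω | ∃ k ≤ 4 ^ m, W ((k : ℕ) * (2 ^ m)⁻¹) ω ∈ Metric.closedBall x (2 * ρ)}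
  have hA : Monotone A := by
    refine monotone_nat_of_le_succ fun m => ?_
    rintro ω ⟨k, hk, h⟩
    refine ⟨2 * k, by rw [pow_succ]; omega, ?_⟩
    convert h using 2
    push_cast
    rw [pow_succ]
    field_simp
  have hsub : P {ω | ∃ t, W t ω ∈ Metric.closedBall x ρ} ≤ P (⋃ m, A m) := by
    refine measure_mono_ae ?_
    filter_upwards [hW.ae_continuous] with ω hω
    rintro ⟨t, ht⟩
    obtain ⟨m, k, hk, h⟩ := exists_dyadic_mem_of_isOpen
      ((Metric.isOpen_ball (x := x) (ε := 2 * ρ)).preimage hω)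
      ⟨t, Metric.closedBall_subset_ball (by linarith) ht⟩
    exact mem_iUnion.2 ⟨m, k, hk, Metric.ball_subset_closedBall h⟩
  calc _ ≤ heatPotential d 1 * P (⋃ m, A m) := by gcongr
    _ = ⨆ m, heatPotential d 1 * P (A m) := by rw [hA.measure_iUnion, ENNReal.mul_iSup]
    _ ≤ _ := iSup_le fun m =>
      heatPotential_mul_grid_hit_le hW (by positivity) (by positivity) x (4 ^ m)

/-- Brownian motion in dimension at least three is unlikely to hit a ball whose radius is small
compared with the norm of its centre. -/
lemma exists_hit_le {d : ℕ} (hd : 3 ≤ d) {η : ENNReal} (hη : 0 < η) :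
    ∃ δ : ℝ, 0 < δ ∧ ∀ (x : EuclideanSpace ℝ (Fin d)), x ≠ 0 →
      ∀ (Ω : Type u) [MeasurableSpace Ω] (P : Measure Ω) [IsProbabilityMeasure P]
        (W : ℝ≥0 → Ω → EuclideanSpace ℝ (Fin d)), IsBrownianVec W P →
        P {ω | ∃ t, W t ω ∈ Metric.closedBall x (δ * ‖x‖)} ≤ η := by
  have hpos := heatPotential_pos d 1
  obtain ⟨L, hL, h⟩ := exists_heatPotential_le hd (ENNReal.mul_pos hpos.ne' hη.ne')
  have hsq : 0 < √L := Real.sqrt_pos.2 hL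
  -- With this δ the argument |x|²/(2δ|x|)² of the potential is exactly L.
  refine ⟨(2 * √L)⁻¹, by positivity, fun x hx Ω _ P _ W hW => ?_⟩
  have hx' : 0 < ‖x‖ := norm_pos_iff.2 hx
  have hq : L = ‖x‖ ^ 2 / (2 * ((2 * √L)⁻¹ * ‖x‖)) ^ 2 := by
    field_simp
    exact (Real.sq_sqrt hL.le).symm
  have hhit := (heatPotential_mul_hit_le hW (by positivity) x).trans (h _ hq.le)
  exact (ENNReal.mul_le_mul_iff_right hpos.ne' (heatPotential_ne_top hd zero_le_one)).1 hhit

/-! ### Lattice clusters -/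

/-- The point of Euclidean space with the given natural coordinates. -/
noncomputable def latticePoint {d : ℕ} (p : Fin d → ℕ) : EuclideanSpace ℝ (Fin d) :=
  WithLp.toLp 2 fun i => (p i : ℝ)

/-- Translation by `R` in the direction of the first coordinate. -/
def shiftFirst {d : ℕ} (R : ℕ) (m : Fin d → ℕ) (i : Fin d) : ℕ :=
  if (i : ℕ) = 0 then R + m i else m i

lemma one_le_norm_latticePoint_sub {d : ℕ} {p q : Fin d → ℕ} (h : p ≠ q) :
    1 ≤ ‖latticePoint p - latticePoint q‖ := by
  obtain ⟨i, hi⟩ := Function.ne_iff.1 h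
  refine le_trans ?_ (PiLp.norm_apply_le (latticePoint p - latticePoint q) i)
  have h1 : (1 : ℤ) ≤ |(p i : ℤ) - q i| := Int.one_le_abs (sub_ne_zero.2 (by exact_mod_cast hi))
  simp only [latticePoint, PiLp.sub_apply, Real.norm_eq_abs]
  exact_mod_cast h1

lemma le_norm_latticePoint_shiftFirst {d : ℕ} (hd : 0 < d) (R : ℕ) (m : Fin d → ℕ) :
    (R : ℝ) ≤ ‖latticePoint (shiftFirst R m)‖ := by
  refine le_trans ?_ (PiLp.norm_apply_le (latticePoint (shiftFirst R m)) ⟨0, hd⟩)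
  simp only [latticePoint, shiftFirst, if_true, Real.norm_eq_abs, Nat.abs_cast]
  exact_mod_cast Nat.le_add_right _ _

lemma norm_latticePoint_le {d M : ℕ} {m : Fin d → ℕ} (hm : ∀ i, m i ≤ M) :
    ‖latticePoint m‖ ≤ d * M := by
  refine le_of_sq_le_sq ?_ (by positivity)
  rw [EuclideanSpace.real_norm_sq_eq]
  calc ∑ i, (latticePoint m i) ^ 2 ≤ ∑ _i : Fin d, (M : ℝ) ^ 2 := by
        refine Finset.sum_le_sum fun i _ => ?_
        have : (m i : ℝ) ≤ M := by exact_mod_cast hm i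
        simp only [latticePoint]
        gcongr
    _ = d * (M : ℝ) ^ 2 := by simp
    _ ≤ (d : ℝ) ^ 2 * (M : ℝ) ^ 2 := by
        gcongr
        exact_mod_cast Nat.le_self_pow two_ne_zero d
    _ = _ := by ring

lemma latticePoint_shiftFirst_sub {d : ℕ} (R : ℕ) (m : Fin d → ℕ) :
    latticePoint (shiftFirst R m) - latticePoint (shiftFirst R 0) = latticePoint m := by
  ext i
  by_cases h : (i : ℕ) = 0 <;> simp [latticePoint, shiftFirst, h]

lemma norm_latticePoint_shiftFirst_zero {d : ℕ} (hd : 0 < d) (R : ℕ) :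
    ‖latticePoint (shiftFirst R (0 : Fin d → ℕ))‖ = R := by
  have : latticePoint (shiftFirst R (0 : Fin d → ℕ)) = EuclideanSpace.single ⟨0, hd⟩ (R : ℝ) := by
    ext i
    by_cases h : (i : ℕ) = 0 <;> simp [latticePoint, shiftFirst, h, Fin.ext_iff]
  rw [this]
  simp

lemma eventually_le_of_monotoneOn_of_not_bddAbove {f : ℝ → ℝ} (hf : MonotoneOn f (Ici 0))
    (hf' : ¬ BddAbove (f '' Ici 0)) (T : ℝ) : ∀ᶠ x in atTop, T ≤ f x := by
  rw [not_bddAbove_iff] at hf'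
  obtain ⟨_, ⟨a, ha, rfl⟩, hT⟩ := hf' T
  filter_upwards [eventually_ge_atTop a] with x hx
  exact hT.le.trans (hf ha (mem_Ici.2 (le_trans ha hx)) hx)

/-- A cube of `M ^ d` lattice points at distance `R = C * M` from the origin, taken as centres of
balls of a common radius `r`, contributes at least one to the sum of capacities although it lies in
a ball of radius `δ * R`. -/
lemma exists_cluster {d : ℕ} (hd : 3 ≤ d) {f : ℝ → ℝ} (hf : MonotoneOn f (Ici 0))
    (hf' : ¬ BddAbove (f '' Ici 0)) {δ : ℝ} (hδ : 0 < δ) :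
    ∃ C : ℕ, 1 ≤ C ∧ ∀ᶠ M : ℕ in atTop, 1 ≤ M ∧ ∃ r : ℝ, 0 < r ∧ r ≤ 1 / 4 ∧
      ∀ m : Fin d → ℕ, (∀ i, m i < M) →
        ‖latticePoint m‖ + r ≤ δ * (C * M : ℕ) ∧
        r ^ (d - 2) * ‖latticePoint (shiftFirst (C * M) m)‖ ^ 2 ≤
          f ‖latticePoint (shiftFirst (C * M) m)‖ ∧
        (1 / M : ℝ) ^ d ≤ (r / ‖latticePoint (shiftFirst (C * M) m)‖) ^ (d - 2) := by
  have hd0 : 0 < d := by omega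
  have hd2 : d - 2 ≠ 0 := by omega
  -- The first bound fits the cube, of size at most dM, and the radius r inside δR; the second keeps
  -- all centres within 2R of the origin.
  obtain ⟨C, hC⟩ := exists_nat_ge (max ((d + 1) / δ) (d + 1))
  have hC1 : (d + 1 : ℝ) ≤ δ * C := by
    have := (le_max_left _ _).trans hC
    rwa [div_le_iff₀' hδ] at this
  have hC2 : (d + 1 : ℝ) ≤ C := (le_max_right _ _).trans hC
  have hC0 : 0 < C := by
    have : (0 : ℝ) < C := by linarith [(d.cast_nonneg : (0 : ℝ) ≤ d)]
    exact_mod_cast this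
  have hlim : Tendsto (fun M : ℕ => ((C * M : ℕ) : ℝ)) atTop atTop :=
    tendsto_natCast_atTop_atTop.comp (tendsto_id.const_mul_atTop' hC0)
  have hlim2 : Tendsto (fun M : ℕ => (1 / 4 : ℝ) ^ (d - 2) * ((C * M : ℕ) : ℝ) ^ 2) atTop atTop :=
    ((tendsto_pow_atTop two_ne_zero).comp hlim).const_mul_atTop (by positivity)
  -- Large enough that T/(R²(2R)^(d-2)) ≥ M^(-d) when R = CM.
  let T : ℝ := (2 * C) ^ d
  have hT : 0 < T := by positivity
  refine ⟨C, hC0, ?_⟩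
  filter_upwards [eventually_ge_atTop 1,
    hlim.eventually (eventually_le_of_monotoneOn_of_not_bddAbove hf hf' (4 * T)),
    hlim2.eventually_ge_atTop T] with M hM hfM hTM
  refine ⟨hM, ?_⟩
  have hM' : (1 : ℝ) ≤ M := by exact_mod_cast hM
  set R : ℕ := C * M with hR
  have hRcast : (R : ℝ) = C * M := by simp [hR]
  have hR0 : (0 : ℝ) < R := by rw [hRcast]; positivity
  have hr := Real.rpow_inv_natCast_pow (x := T / (R : ℝ) ^ 2) (by positivity) hd2
  set r : ℝ := (T / (R : ℝ) ^ 2) ^ (((d - 2 : ℕ) : ℝ)⁻¹)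
  have hr0 : 0 < r := Real.rpow_pos_of_pos (by positivity) _
  have hr4 : r ≤ 1 / 4 := by
    refine le_of_pow_le_pow_left₀ hd2 (by norm_num) ?_
    rw [hr, div_le_iff₀ (by positivity)]
    exact hTM
  refine ⟨r, hr0, hr4, fun m hm => ?_⟩
  have hnm : ‖latticePoint m‖ ≤ d * M := norm_latticePoint_le fun i => (hm i).le
  have hlow := le_norm_latticePoint_shiftFirst hd0 R m
  have hup : ‖latticePoint (shiftFirst R m)‖ ≤ 2 * R := by
    have h1 : latticePoint (shiftFirst R m) =
        latticePoint (shiftFirst R 0) + latticePoint m := by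
      rw [← latticePoint_shiftFirst_sub R m]
      abel
    rw [h1]
    refine (norm_add_le _ _).trans ?_
    rw [norm_latticePoint_shiftFirst_zero hd0]
    have : (d : ℝ) * M ≤ R := by
      rw [hRcast]
      gcongr
      exact_mod_cast (le_add_of_nonneg_right zero_le_one).trans hC2
    linarith
  refine ⟨?_, ?_, ?_⟩
  · have : (d + 1 : ℝ) * M ≤ δ * C * M := by gcongr
    rw [hRcast]
    nlinarith
  · calc r ^ (d - 2) * ‖latticePoint (shiftFirst R m)‖ ^ 2
        ≤ T / (R : ℝ) ^ 2 * (2 * R) ^ 2 := by rw [hr]; gcongr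
      _ = 4 * T := by field_simp; norm_num
      _ ≤ f R := hfM
      _ ≤ _ := hf (mem_Ici.2 hR0.le) (mem_Ici.2 (norm_nonneg _)) hlow
  · rw [div_pow r, hr]
    calc (1 / M : ℝ) ^ d ≤ T / (R : ℝ) ^ 2 / (2 * R) ^ (d - 2) := by
          rw [div_div, mul_pow, mul_left_comm, ← pow_add, show 2 + (d - 2) = d by omega, hRcast,
            div_pow, one_pow, div_le_div_iff₀ (by positivity) (by positivity)]
          simp only [T, mul_pow]
          have : (2 : ℝ) ^ (d - 2) ≤ 2 ^ d := pow_le_pow_right₀ one_le_two (by omega)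
          calc _ = (2 : ℝ) ^ (d - 2) * ((C : ℝ) ^ d * M ^ d) := by ring
            _ ≤ (2 : ℝ) ^ d * ((C : ℝ) ^ d * M ^ d) := by gcongr
            _ = _ := by ring
      _ ≤ _ := by
          have : 0 < ‖latticePoint (shiftFirst R m)‖ := hR0.trans_le hlow
          gcongr

/-! ### Assembling the clusters -/

/-- Natural numbers chosen above prescribed thresholds, and growing as fast as prescribed. -/
lemma exists_seq_growing {p : ℕ → ℕ → Prop} (hp : ∀ k, ∀ᶠ M in atTop, p k M) (g : ℕ → ℕ → ℕ) :
    ∃ M : ℕ → ℕ, (∀ k, p k (M k)) ∧ ∀ k, g k (M k) ≤ M (k + 1) := by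
  choose N hN using fun k => eventually_atTop.1 (hp k)
  refine ⟨fun k => Nat.rec (N 0) (fun k a => max (N (k + 1)) (g k a)) k, fun k => ?_,
    fun k => le_max_right _ _⟩
  cases k with
  | zero => exact hN 0 _ le_rfl
  | succ k => exact hN (k + 1) _ (le_max_left _ _)

/-- Lattice points in cubes that follow each other along the first axis are distinct. -/
lemma injective_shiftFirst {d : ℕ} (hd : 0 < d) {R M : ℕ → ℕ} (h : ∀ k, R k + M k ≤ R (k + 1)) :
    Function.Injective fun a : Σ k, Fin d → Fin (M k) =>
      shiftFirst (R a.1) fun i => (a.2 i : ℕ) := by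
  have hmono : Monotone R := monotone_nat_of_le_succ fun k => by have := h k; omega
  have hlt : ∀ (a b : Σ k, Fin d → Fin (M k)), a.1 < b.1 →
      shiftFirst (R a.1) (fun i => (a.2 i : ℕ)) ⟨0, hd⟩ <
        shiftFirst (R b.1) (fun i => (b.2 i : ℕ)) ⟨0, hd⟩ := by
    intro a b hab
    have h1 := h a.1
    have h2 := hmono (Nat.succ_le_of_lt hab)
    have h3 := (a.2 ⟨0, hd⟩).2
    simp only [shiftFirst, if_true]
    simp only [Nat.succ_eq_add_one] at h2
    omega
  rintro ⟨k, m⟩ ⟨l, n⟩ hab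
  obtain hkl | rfl | hkl := lt_trichotomy k l
  · exact absurd (congrFun hab ⟨0, hd⟩) (hlt ⟨k, m⟩ ⟨l, n⟩ hkl).ne
  · congr 1
    ext i
    have := congrFun hab i
    by_cases hi : (i : ℕ) = 0 <;> simpa [shiftFirst, hi] using this
  · exact absurd (congrFun hab ⟨0, hd⟩) (hlt ⟨l, n⟩ ⟨k, m⟩ hkl).ne'

/-- A collection covered by balls, each of which is unlikely to be hit, is avoidable. -/
lemma isAvoidable_of_subset {d : ℕ} {c : ℕ → EuclideanSpace ℝ (Fin d)} {r : ℕ → ℝ}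
    {B : ℕ → Set (EuclideanSpace ℝ (Fin d))} {η : ℕ → ENNReal} (hη : ∑' k, η k < 1)
    (hB : ∀ k (Ω : Type u) [MeasurableSpace Ω] (P : Measure Ω) [IsProbabilityMeasure P]
        (W : ℝ≥0 → Ω → EuclideanSpace ℝ (Fin d)), IsBrownianVec W P →
        P {ω | ∃ t, W t ω ∈ B k} ≤ η k)
    (hsub : ∀ n, ∃ k, Metric.closedBall (c n) (r n) ⊆ B k) : IsAvoidable.{u} c r := by
  intro Ω _ P _ W hW
  by_contra h
  have h0 := nonpos_iff_eq_zero.1 (not_lt.1 h)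
  have hcover : (univ : Set Ω) ⊆
      {ω | ∀ t, W t ω ∈ ballComplement c r} ∪ ⋃ k, {ω | ∃ t, W t ω ∈ B k} := by
    intro ω _
    by_cases hω : ∀ t, W t ω ∈ ballComplement c r
    · exact Or.inl hω
    · push Not at hω
      obtain ⟨t, ht⟩ := hω
      rw [ballComplement, notMem_compl_iff, mem_iUnion] at ht
      obtain ⟨n, hn⟩ := ht
      obtain ⟨k, hk⟩ := hsub n
      exact Or.inr (mem_iUnion.2 ⟨k, t, hk hn⟩)
  have : (1 : ENNReal) ≤ ∑' k, η k := by
    calc (1 : ENNReal) = P univ := measure_univ.symm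
      _ ≤ P {ω | ∀ t, W t ω ∈ ballComplement c r} + P (⋃ k, {ω | ∃ t, W t ω ∈ B k}) :=
        (measure_mono hcover).trans (measure_union_le _ _)
      _ = P (⋃ k, {ω | ∃ t, W t ω ∈ B k}) := by rw [h0, zero_add]
      _ ≤ ∑' k, P {ω | ∃ t, W t ω ∈ B k} := measure_iUnion_le _
      _ ≤ _ := ENNReal.tsum_le_tsum fun k => hB k Ω P W hW
  exact absurd hη (not_lt.2 this)

theorem theorem4 (d : ℕ) (hd : 3 ≤ d) (f : ℝ → ℝ) (hf_mono : MonotoneOn f (Ici 0))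
    (hf_unbdd : ¬ BddAbove (f '' Ici 0)) :
    ∃ (c : ℕ → EuclideanSpace ℝ (Fin d)) (r : ℕ → ℝ),
      IsBallCollection c r ∧ IsSeparatedCollection c ∧ IsAvoidable.{u} c r ∧
      (∀ n, r n ^ (d - 2) * ‖c n‖ ^ 2 ≤ f ‖c n‖) ∧
      Tendsto (fun N : ℕ => ∑ n ∈ Finset.range N, (r n / ‖c n‖) ^ (d - 2)) atTop atTop := by
  have hd0 : 0 < d := by omega
  obtain ⟨η, hη0, hη⟩ := ENNReal.exists_pos_sum_of_countable one_ne_zero ℕ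
  choose δ hδ hhit using fun k => exists_hit_le.{u} hd (ENNReal.coe_pos.2 (hη0 k))
  choose C hC hCM using fun k => exists_cluster hd hf_mono hf_unbdd (hδ k)
  -- The growth condition starts each cube beyond the end of the previous one along the first axis.
  obtain ⟨M, hM, hgrow⟩ := exists_seq_growing hCM fun k a => C k * a + a
  choose hM1 ρ hρ hρ4 hcl using hM
  have hsucc : ∀ k, C k * M k + M k ≤ C (k + 1) * M (k + 1) := fun k =>
    (hgrow k).trans (Nat.le_mul_of_pos_left _ (hC _))
  have hinj := injective_shiftFirst hd0 (R := fun k => C k * M k) hsucc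
  have hne : ∀ k, Nonempty (Fin d → Fin (M k)) := fun k => ⟨fun _ => ⟨0, hM1 k⟩⟩
  have hinf : Infinite (Σ k, Fin d → Fin (M k)) :=
    Infinite.of_surjective Sigma.fst fun k => ⟨⟨k, (hne k).some⟩, rfl⟩
  obtain ⟨e⟩ := nonempty_equiv_of_countable (α := ℕ) (β := Σ k, Fin d → Fin (M k))
  let pt : (Σ k, Fin d → Fin (M k)) → Fin d → ℕ := fun a =>
    shiftFirst (C a.1 * M a.1) fun i => (a.2 i : ℕ)
  have hcl' : ∀ a : Σ k, Fin d → Fin (M k), _ := fun a =>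
    hcl a.1 (fun i => (a.2 i : ℕ)) fun i => (a.2 i).2
  have hsep : ∀ n m, n ≠ m → 1 ≤ ‖latticePoint (pt (e n)) - latticePoint (pt (e m))‖ :=
    fun n m hnm => one_le_norm_latticePoint_sub fun h => hnm (e.injective (hinj h))
  have hnorm : ∀ a, 1 ≤ ‖latticePoint (pt a)‖ := fun a =>
    le_trans (by exact_mod_cast Nat.mul_pos (hC a.1) (hM1 a.1))
      (le_norm_latticePoint_shiftFirst hd0 _ _)
  refine ⟨fun n => latticePoint (pt (e n)), fun n => ρ (e n).1,
    ⟨fun n => hρ _, fun n m hnm => ?_, ?_⟩, ⟨1 / 2, by norm_num, fun n m hnm => ?_⟩, ?_,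
    fun n => (hcl' (e n)).2.1, ?_⟩
  · refine Metric.closedBall_disjoint_closedBall ?_
    rw [dist_eq_norm]
    linarith [hsep n m hnm, hρ4 (e n).1, hρ4 (e m).1]
  · rw [ballComplement, mem_compl_iff, mem_iUnion]
    rintro ⟨n, hn⟩
    rw [mem_closedBall_iff_norm, zero_sub, norm_neg] at hn
    linarith [hnorm (e n), hρ4 (e n).1]
  · simpa using hsep n m hnm
  · refine isAvoidable_of_subset hη
      (B := fun k => Metric.closedBall (latticePoint (shiftFirst (C k * M k) 0))
        (δ k * ‖latticePoint (shiftFirst (C k * M k) (0 : Fin d → ℕ))‖))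
      (fun k => hhit k _ ?_) fun n => ⟨(e n).1, ?_⟩
    · rw [← norm_pos_iff, norm_latticePoint_shiftFirst_zero hd0]
      exact_mod_cast Nat.mul_pos (hC k) (hM1 k)
    · refine Metric.closedBall_subset_closedBall' ?_
      rw [dist_eq_norm, latticePoint_shiftFirst_sub, norm_latticePoint_shiftFirst_zero hd0,
        add_comm]
      exact (hcl' (e n)).1
  · let g : (Σ k, Fin d → Fin (M k)) → ℝ := fun a => (ρ a.1 / ‖latticePoint (pt a)‖) ^ (d - 2)
    have hg0 : ∀ a, 0 ≤ g a := fun a =>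
      pow_nonneg (div_nonneg (hρ _).le (norm_nonneg _)) _
    -- The terms are nonnegative, so the enumeration `e` is irrelevant and sums may be taken cluster
    -- by cluster; cluster sums of at least 1 cannot tend to 0.
    have hns : ¬ Summable g := by
      rw [summable_sigma_of_nonneg hg0]
      rintro ⟨-, h⟩
      have h1 : ∀ k, 1 ≤ ∑' m, g ⟨k, m⟩ := by
        intro k
        have hMk : (0 : ℝ) < M k := by exact_mod_cast hM1 k
        rw [tsum_fintype]
        calc (1 : ℝ) = ∑ _m : Fin d → Fin (M k), (1 / M k : ℝ) ^ d := by
              simp [hMk.ne']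
          _ ≤ _ := Finset.sum_le_sum fun m _ => (hcl' ⟨k, m⟩).2.2
      have := ge_of_tendsto h.tendsto_atTop_zero (Eventually.of_forall h1)
      linarith
    rw [← not_summable_iff_tendsto_nat_atTop_of_nonneg fun n => hg0 (e n)]
    exact fun h => hns (e.summable_iff.1 h)
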